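/- Let $X\subseteq\mathbb R^m$ and $Y\subseteq\mathbb R^n$ be open and bounded, with $0\in\bar Y$, and let $c:\bar X\times\bar Y\to\mathbb R$ be continuous and Lipschitz in its second variable, uniformly in the first; put $$M_c:=\sup\Big\{\frac{|c(x,y_0)-c(x,y_1)|}{|y_0-y_1|}\;:\;x\in\bar X,\ y_0,y_1\in\bar Y,\ y_0\ne y_1\Big\}<\infty$$ (this holds for instance if $c$ is the restriction of a $C^2$ function defined near $\bar X\times\bar Y$). Let $f:[0,\infty)\to\mathbb R$ be strictly convex, continuously differentiable on $(0,\infty)$, with $f(t)/t\to\infty$ as $t\to\infty$ and $f'(t)\to-\infty$ as $t\to0^+$, so that $f':(0,\infty)\to\mathbb R$ is a bijection with inverse $(f')^{-1}:\mathbb R\to(0,\infty)$. For a bounded measurable $v:Y\to\mathbb R$ let $K_v:(0,\infty)\to\mathbb R$ be the inverse of the increasing bijection $z\mapsto\int_Y(f')^{-1}(z-v(y))\,dy$ from $\mathbb R$ onto $(0,\infty)$; $K_{\pm M_c|y|}$ denotes $K_v$ for $v(y)=\pm M_c|y|$. For probability measures $\mu$ on $\bar X$ and $\nu$ on $\bar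 Y$ let $\mathcal T_c(\mu,\nu)=\inf_{\gamma}\int c\,d\gamma$, the infimum being over all probability measures $\gamma$ on $\bar X\times\bar Y$ with marginals $\mu$ and $\nu$. Let $\mathcal F(\nu)=\int_Y f(\bar\nu(y))\,dy\in(-\infty,+\infty]$ if $\nu$ is absolutely continuous with respect to Lebesgue measure on $Y$, with density $\bar\nu$, and $\mathcal F(\nu)=+\infty$ otherwise. Fix a probability measure $\mu$ on $\bar X$ and let $\nu$ be any minimizer of $\nu\mapsto\mathcal T_c(\mu,\nu)+\mathcal F(\nu)$ over the probability measures on $\bar Y$. Then $\nu$ is absolutely continuous with respect to Lebesgue measure on $Y$, and for Lebesgue-almost every $y\in Y$ its density satisfies $$(f')^{-1}\big(K_{-M_c|y|}(1)-M_c|y|\big)\;\le\;\bar\nu(y)\;\le\;(f')^{-1}\big(K_{M_c|y|}(1)+M_c|y|\big).$$ -/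

import Mathlib

open MeasureTheory Set Filter Topology

noncomputable section

namespace CongestionOT

/-- `ℝ^k` with the Euclidean norm. -/
abbrev E (k : ℕ) : Type := EuclideanSpace ℝ (Fin k)

/-- `P(S)`: the Borel probability measures on `ℝ^k` that are carried by the set `S`. -/
def probOn {k : ℕ} (S : Set (E k)) : Set (Measure (E k)) :=
  {ρ | IsProbabilityMeasure ρ ∧ ρ Sᶜ = 0}

/-- `Π(μ, ν)`: the measures on the product with marginals `μ` and `ν`. -/
def couplings {m n : ℕ} (μ : Measure (E m)) (ν : Measure (E n)) : Set (Measure (E m × E n)) :=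
  {γ | γ.map Prod.fst = μ ∧ γ.map Prod.snd = ν}

/-- The optimal transport cost `T_c(μ, ν)`, the infimum of `∫ c dγ` over `γ ∈ Π(μ, ν)`. It is used
for `c` continuous on a compact set that carries all couplings, where each integral converges and
the infimum is that of a nonempty set that is bounded below. -/
def transportCost {m n : ℕ} (c : E m → E n → ℝ) (μ : Measure (E m)) (ν : Measure (E n)) : ℝ :=
  sInf ((fun γ : Measure (E m × E n) => ∫ p, c p.1 p.2 ∂γ) '' couplings μ ν)

/-- Congestion functions: `f : [0, ∞) → ℝ` is strictly convex, continuously differentiable on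
`(0, ∞)`, superlinear at infinity, and `f'(t) → -∞` as `t → 0⁺`. Values of `f` at negative
arguments play no role. -/
structure IsCongestionFunction (f : ℝ → ℝ) : Prop where
  contDiffOn : ContDiffOn ℝ 1 f (Ioi 0)
  strictConvexOn : StrictConvexOn ℝ (Ici 0) f
  superlinear : Tendsto (fun t => f t / t) atTop atTop
  deriv_zero : Tendsto (deriv f) (𝓝[>] 0) atBot

/-- The Lebesgue density of `ν`. -/
def density {n : ℕ} (ν : Measure (E n)) (y : E n) : ℝ :=
  (ν.rnDeriv volume y).toReal

open Classical in
/-- The congestion functional `F(ν) = ∫_Y f(ν̄(y)) dy`, with `F(ν) = +∞` when `ν` is not absolutely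
continuous with respect to Lebesgue measure on `Y`. For a congestion function and bounded `Y` the
negative part of `f(ν̄)` is integrable over `Y`, so where `f(ν̄)` is not integrable the integral
is `+∞`. -/
def congestion {n : ℕ} (Y : Set (E n)) (f : ℝ → ℝ) (ν : Measure (E n)) : EReal :=
  if ν ≪ volume.restrict Y ∧ IntegrableOn (fun y => f (density ν y)) Y then
    ((∫ y in Y, f (density ν y) : ℝ) : EReal)
  else ⊤

/-- The functional `ν ↦ T_c(μ, ν) + F(ν)`. -/
def energy {m n : ℕ} (Y : Set (E n)) (c : E m → E n → ℝ) (f : ℝ → ℝ) (μ : Measure (E m))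
    (ν : Measure (E n)) : EReal :=
  (transportCost c μ ν : EReal) + congestion Y f ν

/-- `ν` minimizes `T_c(μ, ·) + F` over the probability measures on the closure of `Y`. -/
def IsMinimizer {m n : ℕ} (Y : Set (E n)) (c : E m → E n → ℝ) (f : ℝ → ℝ) (μ : Measure (E m))
    (ν : Measure (E n)) : Prop :=
  ν ∈ probOn (closure Y) ∧ IsMinOn (energy Y c f μ) (probOn (closure Y)) ν

/-- The difference quotients of `c` in the variable `y`, over the closures of `X` and `Y`. The
Euclidean distance of `(x, y₀)` and `(x, y₁)` is `‖y₀ - y₁‖`. -/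
def lipQuotients {m n : ℕ} (X : Set (E m)) (Y : Set (E n)) (c : E m → E n → ℝ) : Set ℝ :=
  {q | ∃ x ∈ closure X, ∃ y₀ ∈ closure Y, ∃ y₁ ∈ closure Y, y₀ ≠ y₁ ∧
    q = |c x y₀ - c x y₁| / ‖y₀ - y₁‖}

/-- `M_c`, the Lipschitz constant of `c` in the variable `y`. -/
def lipConst {m n : ℕ} (X : Set (E m)) (Y : Set (E n)) (c : E m → E n → ℝ) : ℝ :=
  sSup (lipQuotients X Y c)

/-- `(f')⁻¹ : ℝ → (0, ∞)`, the inverse of `f' : (0, ∞) → ℝ` (a bijection for a congestion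
function `f`). -/
def derivInv (f : ℝ → ℝ) : ℝ → ℝ :=
  Function.invFunOn (deriv f) (Ioi 0)

/-- `K_v : (0, ∞) → ℝ`, the inverse of the increasing bijection
`z ↦ ∫_Y (f')⁻¹(z - v(y)) dy` from `ℝ` onto `(0, ∞)`. -/
def K {n : ℕ} (Y : Set (E n)) (f : ℝ → ℝ) (v : E n → ℝ) : ℝ → ℝ :=
  Function.invFun (fun z : ℝ => ∫ y in Y, derivInv f (z - v y))

end CongestionOT

end

/-!
Compare a minimizer `ν` with the measure obtained by moving a small fraction of its mass from a
set `A` near `y₁`, where the density exceeds `s`, uniformly onto a set `B` near `y₂`, where the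
density is below `s'`. To first order the congestion changes by at most `f'(s') - f'(s)` per unit
of mass moved, and the transport cost by at most `M_c |y₁ - y₂|`, since every particle arriving in
`A` can be sent on to `B`. Letting `s` and `s'` tend to the densities shows that `f' ∘ ν̄` is
`M_c`-Lipschitz on a set of full measure; the behaviour of `f'` at `0` keeps the density positive
there.

Hence `ν̄ = (f')⁻¹ ∘ g` almost everywhere, with `g` an `M_c`-Lipschitz function on all of `ℝ^n`.
As `ν` has mass `1` and `K_v` is monotone in `v`, the value of `g` at the base point lies between
`K_{-M_c|y|}(1)` and `K_{M_c|y|}(1)`, and the Lipschitz bound carries this to every other point.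
-/

namespace CongestionOT

open scoped NNReal ENNReal ProbabilityTheory

section CongestionFunction

variable {f : ℝ → ℝ}

lemma add_mul_sub_le_of_convexOn {S : Set ℝ} {f' a b : ℝ} (hf : ConvexOn ℝ S f)
    (hb : HasDerivAt f f' b) (hbS : b ∈ S) (haS : a ∈ S) : f b + f' * (a - b) ≤ f a := by
  rcases lt_trichotomy a b with h | rfl | h
  · have hslope := hf.slope_le_of_hasDerivAt haS hbS h hb
    rw [slope_def_field, div_le_iff₀ (sub_pos.2 h)] at hslope
    linarith
  · simp
  · have hslope := hf.le_slope_of_hasDerivAt hbS haS h hb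
    rw [slope_def_field, le_div_iff₀ (sub_pos.2 h)] at hslope
    linarith

namespace IsCongestionFunction

lemma hasDerivAt (hf : IsCongestionFunction f) {x : ℝ} (hx : 0 < x) :
    HasDerivAt f (deriv f x) x :=
  ((hf.contDiffOn.differentiableOn one_ne_zero).differentiableAt (Ioi_mem_nhds hx)).hasDerivAt

lemma strictMonoOn_deriv (hf : IsCongestionFunction f) : StrictMonoOn (deriv f) (Ioi 0) :=
  (hf.strictConvexOn.subset Ioi_subset_Ici_self (convex_Ioi 0)).strictMonoOn_deriv
    fun _ hx => (hf.hasDerivAt hx).differentiableAt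

lemma continuousOn_deriv (hf : IsCongestionFunction f) : ContinuousOn (deriv f) (Ioi 0) :=
  hf.contDiffOn.continuousOn_deriv_of_isOpen isOpen_Ioi le_rfl

lemma add_deriv_mul_sub_le (hf : IsCongestionFunction f) {a b : ℝ} (ha : 0 ≤ a) (hb : 0 < b) :
    f b + deriv f b * (a - b) ≤ f a :=
  add_mul_sub_le_of_convexOn hf.strictConvexOn.convexOn (hf.hasDerivAt hb) hb.le ha

lemma exists_lt_deriv (hf : IsCongestionFunction f) (z : ℝ) : ∃ x, 0 < x ∧ z < deriv f x := by
  obtain ⟨t, ht, ht1⟩ :=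
    ((hf.superlinear.eventually_gt_atTop (|f 1| + |z|)).and (eventually_ge_atTop 1)).exists
  have ht0 : 0 < t := zero_lt_one.trans_le ht1
  refine ⟨t, ht0, lt_of_not_ge fun hle => ht.not_ge ?_⟩
  rw [div_le_iff₀ ht0]
  calc f t ≤ f 1 + deriv f t * (t - 1) := by
        linarith [hf.add_deriv_mul_sub_le zero_le_one ht0]
    _ ≤ |f 1| + |z| * (t - 1) := by
        gcongr
        exacts [le_abs_self _, hle.trans (le_abs_self z)]
    _ ≤ (|f 1| + |z|) * t := by nlinarith [abs_nonneg (f 1), abs_nonneg z]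

lemma exists_deriv_lt (hf : IsCongestionFunction f) (z : ℝ) : ∃ x, 0 < x ∧ deriv f x < z :=
  ((eventually_mem_nhdsWithin (a := (0 : ℝ)) (s := Ioi 0)).and
    (hf.deriv_zero.eventually_lt_atBot z)).exists

lemma surjOn_deriv (hf : IsCongestionFunction f) : SurjOn (deriv f) (Ioi 0) univ := by
  intro z _
  obtain ⟨a, ha, haz⟩ := hf.exists_deriv_lt z
  obtain ⟨b, hb, hbz⟩ := hf.exists_lt_deriv z
  exact isPreconnected_Ioi.intermediate_value ha hb hf.continuousOn_deriv ⟨haz.le, hbz.le⟩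

lemma derivInv_pos (hf : IsCongestionFunction f) (z : ℝ) : 0 < derivInv f z :=
  Function.invFunOn_mem (hf.surjOn_deriv (mem_univ z))

lemma deriv_derivInv (hf : IsCongestionFunction f) (z : ℝ) : deriv f (derivInv f z) = z :=
  Function.invFunOn_eq (hf.surjOn_deriv (mem_univ z))

lemma derivInv_deriv (hf : IsCongestionFunction f) {x : ℝ} (hx : 0 < x) :
    derivInv f (deriv f x) = x :=
  hf.strictMonoOn_deriv.injOn (hf.derivInv_pos _) hx (hf.deriv_derivInv _)

lemma strictMono_derivInv (hf : IsCongestionFunction f) : StrictMono (derivInv f) := by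
  intro a b hab
  rwa [← hf.strictMonoOn_deriv.lt_iff_lt (hf.derivInv_pos a) (hf.derivInv_pos b),
    hf.deriv_derivInv, hf.deriv_derivInv]

lemma continuous_derivInv (hf : IsCongestionFunction f) : Continuous (derivInv f) := by
  refine continuous_iff_continuousAt.2 fun z => ?_
  refine continuousAt_of_monotoneOn_of_image_mem_nhds (s := univ)
    (hf.strictMono_derivInv.monotone.monotoneOn _) univ_mem ?_
  filter_upwards [Ioi_mem_nhds (hf.derivInv_pos z)] with x hx
  exact ⟨deriv f x, mem_univ _, hf.derivInv_deriv hx⟩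

lemma exists_forall_nonneg_le (hf : IsCongestionFunction f) : ∃ l, ∀ a, 0 ≤ a → l ≤ f a := by
  refine ⟨f (derivInv f 0), fun a ha => ?_⟩
  simpa [hf.deriv_derivInv] using hf.add_deriv_mul_sub_le ha (hf.derivInv_pos 0)

lemma measurable_comp {α : Type*} [MeasurableSpace α] (hf : IsCongestionFunction f) {u : α → ℝ}
    (hu : Measurable u) (hu0 : ∀ y, 0 ≤ u y) : Measurable fun y => f (u y) := by
  classical
  have hpiecewise : Measurable ((Ioi (0 : ℝ)).piecewise f fun _ => f 0) :=
    hf.contDiffOn.continuousOn.measurable_piecewise continuousOn_const measurableSet_Ioi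
  convert hpiecewise.comp hu using 1
  funext y
  rcases (hu0 y).eq_or_lt with h | h
  · simp [← h]
  · simp [Set.piecewise, h]

end IsCongestionFunction

end CongestionFunction

section MassFunction

variable {α : Type*} [MeasurableSpace α] {ρ : Measure α} [IsFiniteMeasure ρ] {f : ℝ → ℝ}
  {v w : α → ℝ} {R : ℝ}

lemma integrable_derivInv_comp (hf : IsCongestionFunction f) (hw : AEStronglyMeasurable w ρ)
    (hwR : ∀ᵐ y ∂ρ, w y ≤ R) : Integrable (fun y => derivInv f (w y)) ρ := by
  refine .of_bound (hf.continuous_derivInv.comp_aestronglyMeasurable hw) (derivInv f R) ?_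
  filter_upwards [hwR] with y hy
  rw [Real.norm_of_nonneg (hf.derivInv_pos _).le]
  exact hf.strictMono_derivInv.monotone hy

lemma integrable_derivInv_sub (hf : IsCongestionFunction f) (hv : AEStronglyMeasurable v ρ)
    (hvR : ∀ᵐ y ∂ρ, |v y| ≤ R) (z : ℝ) : Integrable (fun y => derivInv f (z - v y)) ρ :=
  integrable_derivInv_comp (R := z + R) hf (aestronglyMeasurable_const.sub hv) <| by
    filter_upwards [hvR] with y hy using by linarith [neg_le_of_abs_le hy]

lemma strictMono_integral_derivInv_sub (hf : IsCongestionFunction f)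
    (hv : AEStronglyMeasurable v ρ) (hvR : ∀ᵐ y ∂ρ, |v y| ≤ R) (hρ : ρ ≠ 0) :
    StrictMono fun z : ℝ => ∫ y, derivInv f (z - v y) ∂ρ := by
  intro a b hab
  have hlt : ∀ y, 0 < derivInv f (b - v y) - derivInv f (a - v y) := fun y =>
    sub_pos.2 (hf.strictMono_derivInv (sub_lt_sub_right hab _))
  have hint := integrable_derivInv_sub hf hv hvR
  have hpos : 0 < ∫ y, (derivInv f (b - v y) - derivInv f (a - v y)) ∂ρ := by
    rw [integral_pos_iff_support_of_nonneg (fun y => (hlt y).le) ((hint b).sub (hint a)),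
      eq_univ_of_forall (s := Function.support _) fun y => (hlt y).ne']
    exact Measure.measure_univ_pos.2 hρ
  rwa [integral_sub (hint b) (hint a), sub_pos] at hpos

lemma continuous_integral_derivInv_sub (hf : IsCongestionFunction f)
    (hv : AEStronglyMeasurable v ρ) (hvR : ∀ᵐ y ∂ρ, |v y| ≤ R) :
    Continuous fun z : ℝ => ∫ y, derivInv f (z - v y) ∂ρ := by
  refine continuous_iff_continuousAt.2 fun z₀ => ?_
  refine continuousAt_of_dominated (bound := fun _ => derivInv f (z₀ + 1 + R))
    (.of_forall fun z => (integrable_derivInv_sub hf hv hvR z).aestronglyMeasurable) ?_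
    (integrable_const _)
    (.of_forall fun y => (hf.continuous_derivInv.comp (continuous_sub_right _)).continuousAt)
  filter_upwards [Iio_mem_nhds (lt_add_one z₀)] with z hz
  filter_upwards [hvR] with y hy
  rw [Real.norm_of_nonneg (hf.derivInv_pos _).le]
  exact hf.strictMono_derivInv.monotone (by linarith [neg_le_of_abs_le hy, mem_Iio.1 hz])

lemma exists_integral_derivInv_sub_eq (hf : IsCongestionFunction f)
    (hv : AEStronglyMeasurable v ρ) (hvR : ∀ᵐ y ∂ρ, |v y| ≤ R) (hρ : ρ ≠ 0) {b : ℝ}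
    (hb : 0 < b) : ∃ z, ∫ y, derivInv f (z - v y) ∂ρ = b := by
  have hmass : 0 < ρ.real univ :=
    ENNReal.toReal_pos (Measure.measure_univ_ne_zero.2 hρ) (measure_ne_top _ _)
  set z₀ := deriv f (b / ρ.real univ)
  have hconst : ∫ _, derivInv f z₀ ∂ρ = b := by
    rw [hf.derivInv_deriv (div_pos hb hmass), integral_const, smul_eq_mul,
      mul_div_cancel₀ _ hmass.ne']
  have hmono := hf.strictMono_derivInv.monotone
  have hlow : ∫ y, derivInv f (z₀ - R - v y) ∂ρ ≤ b := by
    rw [← hconst]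
    refine integral_mono_ae (integrable_derivInv_sub hf hv hvR _) (integrable_const _) ?_
    filter_upwards [hvR] with y hy using hmono (by linarith [neg_le_of_abs_le hy])
  have hhigh : b ≤ ∫ y, derivInv f (z₀ + R - v y) ∂ρ := by
    rw [← hconst]
    refine integral_mono_ae (integrable_const _) (integrable_derivInv_sub hf hv hvR _) ?_
    filter_upwards [hvR] with y hy using hmono (by linarith [le_of_abs_le hy])
  exact mem_range_of_exists_le_of_exists_ge (continuous_integral_derivInv_sub hf hv hvR)
    ⟨_, hlow⟩ ⟨_, hhigh⟩

end MassFunction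

section K

variable {n : ℕ} {Y : Set (E n)} {f : ℝ → ℝ} {v w : E n → ℝ} {R b : ℝ}

lemma integral_derivInv_K_sub (hf : IsCongestionFunction f) (hY : volume Y ≠ ∞)
    (hY0 : volume Y ≠ 0) (hv : AEStronglyMeasurable v (volume.restrict Y))
    (hvR : ∀ᵐ y ∂volume.restrict Y, |v y| ≤ R) (hb : 0 < b) :
    ∫ y in Y, derivInv f (K Y f v b - v y) = b :=
  have := isFiniteMeasure_restrict.2 hY
  Function.invFun_eq (f := fun z : ℝ => ∫ y in Y, derivInv f (z - v y))
    (exists_integral_derivInv_sub_eq hf hv hvR (Measure.restrict_eq_zero.not.2 hY0) hb)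

lemma K_integral_derivInv_sub (hf : IsCongestionFunction f) (hY : volume Y ≠ ∞)
    (hY0 : volume Y ≠ 0) (hv : AEStronglyMeasurable v (volume.restrict Y))
    (hvR : ∀ᵐ y ∂volume.restrict Y, |v y| ≤ R) (z : ℝ) :
    K Y f v (∫ y in Y, derivInv f (z - v y)) = z :=
  have := isFiniteMeasure_restrict.2 hY
  Function.leftInverse_invFun (strictMono_integral_derivInv_sub hf hv hvR
    (Measure.restrict_eq_zero.not.2 hY0)).injective z

lemma K_le_K (hf : IsCongestionFunction f) (hY : volume Y ≠ ∞) (hY0 : volume Y ≠ 0)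
    (hv : AEStronglyMeasurable v (volume.restrict Y))
    (hvR : ∀ᵐ y ∂volume.restrict Y, |v y| ≤ R)
    (hw : AEStronglyMeasurable w (volume.restrict Y))
    (hwR : ∀ᵐ y ∂volume.restrict Y, |w y| ≤ R)
    (hvw : ∀ᵐ y ∂volume.restrict Y, v y ≤ w y) (hb : 0 < b) : K Y f v b ≤ K Y f w b := by
  have := isFiniteMeasure_restrict.2 hY
  refine (strictMono_integral_derivInv_sub hf hv hvR
    (Measure.restrict_eq_zero.not.2 hY0)).le_iff_le.1 ?_
  calc ∫ y in Y, derivInv f (K Y f v b - v y) = b :=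
        integral_derivInv_K_sub hf hY hY0 hv hvR hb
    _ = ∫ y in Y, derivInv f (K Y f w b - w y) :=
        (integral_derivInv_K_sub hf hY hY0 hw hwR hb).symm
    _ ≤ ∫ y in Y, derivInv f (K Y f w b - v y) := by
        refine integral_mono_ae (integrable_derivInv_sub hf hw hwR _)
          (integrable_derivInv_sub hf hv hvR _) ?_
        filter_upwards [hvw] with y hy
        exact hf.strictMono_derivInv.monotone (sub_le_sub_left hy _)

/-- Writing `g = g y₀ - v` with `v = g y₀ - g`, the constant `g y₀` is itself a value of `K_v`, and
`v` lies between `-M|y - y₀|` and `M|y - y₀|`. -/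
lemma mem_Icc_K_of_lipschitzWith (hf : IsCongestionFunction f) (hYb : Bornology.IsBounded Y)
    (hYm : MeasurableSet Y) (hY0 : volume Y ≠ 0) {M : ℝ≥0} {g : E n → ℝ} (hg : LipschitzWith M g)
    (hb : 0 < b) (hmass : ∫ y in Y, derivInv f (g y) = b) (y₀ : E n) :
    g y₀ ∈ Icc (K Y f (fun y => -(M * ‖y - y₀‖)) b) (K Y f (fun y => M * ‖y - y₀‖) b) := by
  have hY : volume Y ≠ ∞ := hYb.measure_lt_top.ne
  obtain ⟨R, hR⟩ := hYb.subset_closedBall y₀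
  have hMR : ∀ᵐ y ∂volume.restrict Y, M * ‖y - y₀‖ ≤ M * R := by
    filter_upwards [ae_restrict_mem hYm] with y hy
    exact mul_le_mul_of_nonneg_left (mem_closedBall_iff_norm.1 (hR hy)) M.2
  have hgM : ∀ y, |g y₀ - g y| ≤ M * ‖y - y₀‖ := fun y => by
    rw [norm_sub_rev, ← dist_eq_norm]
    exact hg.dist_le_mul y₀ y
  have hnormR : ∀ᵐ y ∂volume.restrict Y, |M * ‖y - y₀‖| ≤ M * R :=
    hMR.mono fun y hy => by rwa [abs_of_nonneg (by positivity)]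
  have hgR : ∀ᵐ y ∂volume.restrict Y, |g y₀ - g y| ≤ M * R :=
    hMR.mono fun y hy => (hgM y).trans hy
  have hnormc : Continuous fun y => M * ‖y - y₀‖ := by fun_prop
  have hgc : Continuous fun y => g y₀ - g y := continuous_const.sub hg.continuous
  have hK : K Y f (fun y => g y₀ - g y) b = g y₀ := by
    simpa [hmass] using K_integral_derivInv_sub hf hY hY0 hgc.aestronglyMeasurable hgR (g y₀)
  rw [← hK]
  constructor
  · exact K_le_K hf hY hY0 hnormc.neg.aestronglyMeasurable (by simpa only [abs_neg] using hnormR)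
      hgc.aestronglyMeasurable hgR (.of_forall fun y => neg_le_of_abs_le (hgM y)) hb
  · exact K_le_K hf hY hY0 hgc.aestronglyMeasurable hgR hnormc.aestronglyMeasurable hnormR
      (.of_forall fun y => le_of_abs_le (hgM y)) hb

end K

section Transport

lemma integrable_of_continuousOn_of_ae_mem {α : Type*} [TopologicalSpace α] [MeasurableSpace α]
    [OpensMeasurableSpace α] [T2Space α] {γ : Measure α} [IsFiniteMeasure γ] {C : Set α} {c : α → ℝ}
    (hC : IsCompact C) (hc : ContinuousOn c C) (hγ : ∀ᵐ p ∂γ, p ∈ C) : Integrable c γ := by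
  rw [← Measure.restrict_eq_self_of_ae_mem hγ]
  exact hc.integrableOn_compact hC

variable {m n : ℕ} {S : Set (E m)} {T : Set (E n)} {c : E m → E n → ℝ} {μ : Measure (E m)}
  {ν : Measure (E n)} {γ : Measure (E m × E n)}

lemma isProbabilityMeasure_of_mem_couplings [IsProbabilityMeasure μ] (hγ : γ ∈ couplings μ ν) :
    IsProbabilityMeasure γ :=
  have : IsProbabilityMeasure (γ.map Prod.fst) := hγ.1.symm ▸ inferInstance
  Measure.isProbabilityMeasure_of_map Prod.fst

lemma ae_mem_prod_of_mem_couplings (hμ : μ ∈ probOn S) (hν : ν ∈ probOn T)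
    (hγ : γ ∈ couplings μ ν) : ∀ᵐ p ∂γ, p ∈ S ×ˢ T := by
  have hfst : ∀ᵐ p ∂γ, p.1 ∈ S := ae_of_ae_map measurable_fst.aemeasurable (hγ.1 ▸ hμ.2)
  have hsnd : ∀ᵐ p ∂γ, p.2 ∈ T := ae_of_ae_map measurable_snd.aemeasurable (hγ.2 ▸ hν.2)
  filter_upwards [hfst, hsnd] with p hp₁ hp₂ using ⟨hp₁, hp₂⟩

lemma prod_mem_couplings [IsProbabilityMeasure μ] [IsProbabilityMeasure ν] :
    μ.prod ν ∈ couplings μ ν :=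
  ⟨by simp [Measure.map_fst_prod], by simp [Measure.map_snd_prod]⟩

lemma bddBelow_integral_couplings (hS : IsCompact S) (hT : IsCompact T)
    (hc : ContinuousOn (fun p : E m × E n => c p.1 p.2) (S ×ˢ T)) (hμ : μ ∈ probOn S)
    (hν : ν ∈ probOn T) :
    BddBelow ((fun γ : Measure (E m × E n) => ∫ p, c p.1 p.2 ∂γ) '' couplings μ ν) := by
  have := hμ.1
  obtain ⟨l, hl⟩ := (hS.prod hT).bddBelow_image hc
  refine ⟨l, ?_⟩
  rintro _ ⟨γ, hγ, rfl⟩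
  have := isProbabilityMeasure_of_mem_couplings hγ
  have hmem := ae_mem_prod_of_mem_couplings hμ hν hγ
  calc l = ∫ _, l ∂γ := by simp
    _ ≤ ∫ p, c p.1 p.2 ∂γ := by
        refine integral_mono_ae (integrable_const l)
          (integrable_of_continuousOn_of_ae_mem (hS.prod hT) hc hmem) ?_
        filter_upwards [hmem] with p hp using hl (mem_image_of_mem _ hp)

end Transport

section Transfer

variable {α β : Type*} [MeasurableSpace α] [MeasurableSpace β]

/-- The measure obtained from `ν` by moving the fraction `t ≤ 1` of the mass in `A` to the
distribution `τ`: the competitor to which a minimizer is compared. -/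
noncomputable def transfer (ν : Measure β) (A : Set β) (τ : Measure β) (t : ℝ≥0) : Measure β :=
  ν.restrict Aᶜ + (1 - t) • ν.restrict A + (t * ν A) • τ

/-- The plan obtained from `γ` by sending the fraction `t ≤ 1` of the mass that `γ` sends to `A`
to the distribution `τ` instead, independently of its origin. -/
noncomputable def transferPlan (γ : Measure (α × β)) (A : Set β) (τ : Measure β) (t : ℝ≥0) :
    Measure (α × β) :=
  γ.restrict (Prod.snd ⁻¹' Aᶜ) + (1 - t) • γ.restrict (Prod.snd ⁻¹' A)
    + t • ((γ.restrict (Prod.snd ⁻¹' A)).map Prod.fst).prod τ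

variable {γ : Measure (α × β)} {ν τ : Measure β} {A : Set β} {t : ℝ≥0}

lemma map_fst_transferPlan [IsProbabilityMeasure τ] (hA : MeasurableSet A) (ht : t ≤ 1) :
    (transferPlan γ A τ t).map Prod.fst = γ.map Prod.fst := by
  rw [transferPlan, Measure.map_add _ _ measurable_fst, Measure.map_add _ _ measurable_fst,
    Measure.map_smul, Measure.map_smul, Measure.map_fst_prod, measure_univ, one_smul, add_assoc,
    ← add_smul, tsub_add_cancel_of_le ht, one_smul, ← Measure.map_add _ _ measurable_fst,
    preimage_compl, Measure.restrict_compl_add_restrict (measurable_snd hA)]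

lemma map_snd_transferPlan [SFinite τ] (hA : MeasurableSet A) :
    (transferPlan γ A τ t).map Prod.snd = transfer (γ.map Prod.snd) A τ t := by
  rw [transferPlan, transfer, Measure.map_add _ _ measurable_snd,
    Measure.map_add _ _ measurable_snd, Measure.map_smul, Measure.map_smul, Measure.map_snd_prod,
    Measure.restrict_map measurable_snd hA, Measure.restrict_map measurable_snd hA.compl,
    Measure.map_apply measurable_fst .univ, preimage_univ, Measure.restrict_apply_univ,
    Measure.map_apply measurable_snd hA, ← smul_smul]
  rfl

lemma transfer_apply_univ [IsProbabilityMeasure τ] (hA : MeasurableSet A) (ht : t ≤ 1) :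
    transfer ν A τ t univ = ν univ := by
  have hsum : ((1 - t : ℝ≥0) : ℝ≥0∞) + t = 1 := by
    exact_mod_cast tsub_add_cancel_of_le ht
  simp only [transfer, Measure.add_apply, Measure.smul_apply, Measure.restrict_apply_univ,
    measure_univ, smul_eq_mul, mul_one, ENNReal.smul_def]
  rw [add_assoc, ← add_mul, hsum, one_mul, add_comm, measure_add_measure_compl hA]

lemma transfer_absolutelyContinuous {κ : Measure β} (hν : ν ≪ κ) (hτ : τ ≪ κ) :
    transfer ν A τ t ≪ κ := by
  have hrestrict : ∀ s, ν.restrict s ≪ κ := fun s =>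
    Measure.restrict_le_self.absolutelyContinuous.trans hν
  exact ((hrestrict _).add_left ((hrestrict _).smul_left _)).add_left (hτ.smul_left _)

lemma transfer_mem_probOn {k : ℕ} {ν τ : Measure (E k)} {A T : Set (E k)} (hν : ν ∈ probOn T)
    (hτ : τ ∈ probOn T) (hA : MeasurableSet A) (ht : t ≤ 1) : transfer ν A τ t ∈ probOn T := by
  have := hν.1
  have := hτ.1
  refine ⟨⟨by rw [transfer_apply_univ hA ht, measure_univ]⟩, ?_⟩
  have hrestrict : ∀ s, ν.restrict s Tᶜ = 0 := fun s =>
    Measure.restrict_le_self.absolutelyContinuous hν.2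
  simp [transfer, hrestrict, hτ.2]

lemma integral_prod_map_fst_le [IsFiniteMeasure γ] [IsProbabilityMeasure τ] {P : Set (α × β)}
    {B : Set β} {c : α × β → ℝ} {L : ℝ} (hc : Integrable c γ)
    (hcτ : Integrable c ((γ.map Prod.fst).prod τ)) (hγ : ∀ᵐ p ∂γ, p ∈ P) (hτ : ∀ᵐ y ∂τ, y ∈ B)
    (hL : ∀ p ∈ P, ∀ y ∈ B, c (p.1, y) ≤ c p + L) :
    ∫ p, c p ∂(γ.map Prod.fst).prod τ ≤ ∫ p, c p ∂γ + γ.real univ * L := by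
  have hmap : (γ.map Prod.fst).prod τ = (γ.prod τ).map (Prod.map Prod.fst id) := by
    simpa using Measure.map_prod_map γ τ measurable_fst measurable_id
  have hmeas : AEMeasurable (Prod.map Prod.fst id : (α × β) × β → α × β) (γ.prod τ) := by
    fun_prop
  have hcL : Integrable (fun p => c p + L) γ := hc.add (integrable_const L)
  rw [hmap] at hcτ ⊢
  calc ∫ p, c p ∂(γ.prod τ).map (Prod.map Prod.fst id)
      = ∫ q, c (q.1.1, q.2) ∂γ.prod τ := integral_map hmeas hcτ.aestronglyMeasurable
    _ ≤ ∫ q, (c q.1 + L) ∂γ.prod τ := by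
        refine integral_mono_ae (hcτ.comp_aemeasurable hmeas) (hcL.comp_fst τ) ?_
        filter_upwards [Measure.quasiMeasurePreserving_fst.ae hγ,
          Measure.quasiMeasurePreserving_snd.ae hτ] with q hq₁ hq₂ using hL _ hq₁ _ hq₂
    _ = ∫ p, c p ∂γ + γ.real univ * L := by
        rw [integral_fun_fst (fun p => c p + L), integral_add hc (integrable_const L)]
        simp

lemma integral_transferPlan_le [IsFiniteMeasure γ] [IsProbabilityMeasure τ] {P : Set (α × β)}
    {B : Set β} {c : α × β → ℝ} {L : ℝ} (hA : MeasurableSet A) (ht : t ≤ 1)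
    (hc : Integrable c γ)
    (hcτ : Integrable c (((γ.restrict (Prod.snd ⁻¹' A)).map Prod.fst).prod τ))
    (hγ : ∀ᵐ p ∂γ, p ∈ P) (hτ : ∀ᵐ y ∂τ, y ∈ B)
    (hL : ∀ p ∈ P, p.2 ∈ A → ∀ y ∈ B, c (p.1, y) ≤ c p + L) :
    ∫ p, c p ∂transferPlan γ A τ t
      ≤ ∫ p, c p ∂γ + t * ((γ.map Prod.snd).real A * L) := by
  have hA' : MeasurableSet (Prod.snd ⁻¹' A : Set (α × β)) := measurable_snd hA
  have hcA := hc.mono_measure (Measure.restrict_le_self (s := Prod.snd ⁻¹' A))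
  have hcAc := hc.mono_measure (Measure.restrict_le_self (s := Prod.snd ⁻¹' Aᶜ))
  have hsplit : ∫ p in Prod.snd ⁻¹' A, c p ∂γ + ∫ p in Prod.snd ⁻¹' Aᶜ, c p ∂γ = ∫ p, c p ∂γ :=
    integral_add_compl hA' hc
  have hmoved : ∫ p, c p ∂((γ.restrict (Prod.snd ⁻¹' A)).map Prod.fst).prod τ
      ≤ ∫ p in Prod.snd ⁻¹' A, c p ∂γ + (γ.map Prod.snd).real A * L := by
    refine (integral_prod_map_fst_le (P := {p | p ∈ P ∧ p.2 ∈ A}) hcA hcτ ?_ hτ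
      fun p hp => hL p hp.1 hp.2).trans_eq ?_
    · filter_upwards [ae_restrict_of_ae hγ, ae_restrict_mem hA'] with p hp hpA using ⟨hp, hpA⟩
    · simp [map_measureReal_apply measurable_snd hA]
  rw [transferPlan, integral_add_measure (hcAc.add_measure (hcA.smul_measure_nnreal))
    hcτ.smul_measure_nnreal, integral_add_measure hcAc hcA.smul_measure_nnreal,
    integral_smul_nnreal_measure, integral_smul_nnreal_measure, NNReal.smul_def, NNReal.smul_def,
    NNReal.coe_sub ht, NNReal.coe_one, smul_eq_mul, smul_eq_mul, ← hsplit]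
  linarith [mul_le_mul_of_nonneg_left hmoved t.coe_nonneg]

lemma transportCost_transfer_le {m n : ℕ} {S : Set (E m)} {T A B : Set (E n)}
    {c : E m → E n → ℝ} {μ : Measure (E m)} {ν τ : Measure (E n)} {L : ℝ} (hS : IsCompact S)
    (hT : IsCompact T) (hc : ContinuousOn (fun p : E m × E n => c p.1 p.2) (S ×ˢ T))
    (hμ : μ ∈ probOn S) (hν : ν ∈ probOn T) (hτ : τ ∈ probOn B) (hBT : B ⊆ T)
    (hA : MeasurableSet A) (ht : t ≤ 1) (hL : ∀ x ∈ S, ∀ y ∈ A, ∀ y' ∈ B, c x y' ≤ c x y + L) :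
    transportCost c μ (transfer ν A τ t) ≤ transportCost c μ ν + t * (ν.real A * L) := by
  have := hμ.1
  have := hν.1
  have := hτ.1
  have hτT : τ ∈ probOn T := ⟨hτ.1, measure_mono_null (compl_subset_compl.2 hBT) hτ.2⟩
  rw [← sub_le_iff_le_add]
  refine le_csInf ⟨_, mem_image_of_mem _ prod_mem_couplings⟩ ?_
  rintro _ ⟨γ, hγ, rfl⟩
  rw [sub_le_iff_le_add]
  have := isProbabilityMeasure_of_mem_couplings hγ
  have hmem := ae_mem_prod_of_mem_couplings hμ hν hγ
  have hplan : transferPlan γ A τ t ∈ couplings μ (transfer ν A τ t) :=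
    ⟨by rw [map_fst_transferPlan hA ht, hγ.1], by rw [map_snd_transferPlan hA, hγ.2]⟩
  have hfst : ∀ᵐ x ∂(γ.restrict (Prod.snd ⁻¹' A)).map Prod.fst, x ∈ S :=
    Measure.absolutelyContinuous_of_le (Measure.map_mono Measure.restrict_le_self measurable_fst)
      (hγ.1 ▸ hμ.2)
  have hprod : ∀ᵐ p ∂((γ.restrict (Prod.snd ⁻¹' A)).map Prod.fst).prod τ, p ∈ S ×ˢ T := by
    filter_upwards [Measure.quasiMeasurePreserving_fst.ae hfst,
      Measure.quasiMeasurePreserving_snd.ae hτT.2] with p hp₁ hp₂ using ⟨hp₁, hp₂⟩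
  calc transportCost c μ (transfer ν A τ t)
      ≤ ∫ p, c p.1 p.2 ∂transferPlan γ A τ t :=
        csInf_le (bddBelow_integral_couplings hS hT hc hμ (transfer_mem_probOn hν hτT hA ht))
          (mem_image_of_mem _ hplan)
    _ ≤ ∫ p, c p.1 p.2 ∂γ + t * (ν.real A * L) := by
        rw [← hγ.2]
        exact integral_transferPlan_le hA ht
          (integrable_of_continuousOn_of_ae_mem (hS.prod hT) hc hmem)
          (integrable_of_continuousOn_of_ae_mem (hS.prod hT) hc hprod) hmem hτ.2
          fun p hp hpA y hy => hL p.1 hp.1 p.2 hpA y hy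

end Transfer

section Density

variable {n : ℕ} {ν τ : Measure (E n)} {A B : Set (E n)}

lemma density_nonneg (y : E n) : 0 ≤ density ν y := ENNReal.toReal_nonneg

lemma measurable_density : Measurable (density ν) :=
  (Measure.measurable_rnDeriv ν volume).ennreal_toReal

lemma integrable_density [IsFiniteMeasure ν] : Integrable (density ν) :=
  Measure.integrable_toReal_rnDeriv

lemma setIntegral_density [SigmaFinite ν] (hν : ν ≪ volume) (s : Set (E n)) :
    ∫ y in s, density ν y = ν.real s :=
  Measure.setIntegral_toReal_rnDeriv hν s

lemma density_add [SigmaFinite ν] [SigmaFinite τ] :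
    density (ν + τ) =ᵐ[volume] fun y => density ν y + density τ y := by
  filter_upwards [Measure.rnDeriv_add' ν τ volume, Measure.rnDeriv_lt_top ν volume,
    Measure.rnDeriv_lt_top τ volume] with y hy hν hτ
  rw [density, hy, Pi.add_apply, ENNReal.toReal_add hν.ne hτ.ne, density, density]

lemma density_smul [SigmaFinite ν] (r : ℝ≥0) :
    density (r • ν) =ᵐ[volume] fun y => r * density ν y := by
  filter_upwards [Measure.rnDeriv_smul_left' ν volume r] with y hy
  rw [density, hy, Pi.smul_apply, ENNReal.toReal_smul, NNReal.smul_def, smul_eq_mul, density]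

lemma density_restrict [SigmaFinite ν] (hA : MeasurableSet A) :
    density (ν.restrict A) =ᵐ[volume] A.indicator (density ν) := by
  filter_upwards [Measure.rnDeriv_restrict ν volume hA] with y hy
  rw [density, hy]
  by_cases hyA : y ∈ A <;> simp [hyA, density]

lemma density_cond (hB : MeasurableSet B) (hB0 : volume B ≠ 0) :
    density volume[|B] =ᵐ[volume] B.indicator fun _ => (volume.real B)⁻¹ := by
  filter_upwards [Measure.rnDeriv_smul_left_of_ne_top' (volume.restrict B) volume
    (ENNReal.inv_ne_top.2 hB0), Measure.rnDeriv_restrict_self volume hB] with y hy hyB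
  rw [density, ProbabilityTheory.cond, hy, Pi.smul_apply, hyB]
  by_cases hy' : y ∈ B <;> simp [hy', Measure.real]

lemma density_transfer [IsFiniteMeasure ν] [IsProbabilityMeasure τ] (hA : MeasurableSet A)
    {t : ℝ≥0} (ht : t ≤ 1) :
    density (transfer ν A τ t) =ᵐ[volume]
      fun y => density ν y - t * A.indicator (density ν) y + t * ν.real A * density τ y := by
  have htA : t * ν A = (t * (ν A).toNNReal : ℝ≥0) := by
    simp [ENNReal.coe_toNNReal (measure_ne_top ν A)]
  have hsmul : (t * ν A) • τ = (t * (ν A).toNNReal) • τ := by rw [htA]; rfl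
  rw [transfer, hsmul]
  filter_upwards [density_add (ν := ν.restrict Aᶜ + (1 - t) • ν.restrict A)
      (τ := (t * (ν A).toNNReal) • τ),
    density_add (ν := ν.restrict Aᶜ) (τ := (1 - t) • ν.restrict A),
    density_smul (ν := ν.restrict A) (1 - t), density_smul (ν := τ) (t * (ν A).toNNReal),
    density_restrict (ν := ν) hA, density_restrict (ν := ν) hA.compl] with y h₁ h₂ h₃ h₄ h₅ h₆
  rw [h₁, h₂, h₃, h₄, h₅, h₆, NNReal.coe_sub ht, NNReal.coe_one, NNReal.coe_mul]
  have hreal : ((ν A).toNNReal : ℝ) = ν.real A := rfl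
  rw [hreal]
  by_cases hy : y ∈ A
  · simp only [hy, not_true_eq_false, mem_compl_iff, not_false_eq_true, indicator_of_mem,
      indicator_of_notMem]
    ring
  · simp [hy]

end Density

section Variation

variable {f : ℝ → ℝ} {s s' t κ a : ℝ}

lemma IsCongestionFunction.apply_one_sub_mul_le (hf : IsCongestionFunction f) (hs : 0 < s)
    (hsa : s ≤ a) (ht0 : 0 ≤ t) (ht1 : t < 1) :
    f ((1 - t) * a) ≤ f a - t * a * deriv f ((1 - t) * s) := by
  have ha : 0 < a := hs.trans_le hsa
  have ht : 0 < 1 - t := sub_pos.2 ht1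
  have hderiv : deriv f ((1 - t) * s) ≤ deriv f ((1 - t) * a) :=
    hf.strictMonoOn_deriv.monotoneOn (mul_pos ht hs) (mul_pos ht ha) (by gcongr)
  have htangent := hf.add_deriv_mul_sub_le ha.le (mul_pos ht ha)
  have hmono := mul_le_mul_of_nonneg_left hderiv (mul_nonneg ht0 ha.le)
  linarith

lemma IsCongestionFunction.apply_add_le (hf : IsCongestionFunction f) (ha : 0 ≤ a) (has : a ≤ s')
    (hκ : 0 < κ) : f (a + κ) ≤ f a + κ * deriv f (s' + κ) := by
  have hderiv : deriv f (a + κ) ≤ deriv f (s' + κ) :=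
    hf.strictMonoOn_deriv.monotoneOn (mem_Ioi.2 (by linarith)) (mem_Ioi.2 (by linarith))
      (by gcongr)
  have htangent := hf.add_deriv_mul_sub_le ha (by linarith : 0 < a + κ)
  have hmono := mul_le_mul_of_nonneg_left hderiv hκ.le
  linarith

variable {α : Type*} [MeasurableSpace α] {ρ : Measure α} [IsFiniteMeasure ρ] {u : α → ℝ}
  {A B : Set α}

lemma integrable_and_integral_comp_sub_add_le (hf : IsCongestionFunction f) (hu : Measurable u)
    (hu0 : ∀ y, 0 ≤ u y) (hui : Integrable u ρ) (hfu : Integrable (fun y => f (u y)) ρ)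
    (hA : MeasurableSet A) (hB : MeasurableSet B) (hAB : Disjoint A B) (hs : 0 < s)
    (hAs : ∀ y ∈ A, s ≤ u y) (hBs : ∀ y ∈ B, u y ≤ s') (ht0 : 0 ≤ t) (ht1 : t < 1) (hκ : 0 < κ) :
    Integrable (fun y => f (u y - t * A.indicator u y + B.indicator (fun _ => κ) y)) ρ ∧
      ∫ y, f (u y - t * A.indicator u y + B.indicator (fun _ => κ) y) ∂ρ
        ≤ ∫ y, f (u y) ∂ρ - t * deriv f ((1 - t) * s) * ∫ y in A, u y ∂ρ
          + ρ.real B * (κ * deriv f (s' + κ)) := by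
  set u' := fun y => u y - t * A.indicator u y + B.indicator (fun _ => κ) y
  have hu' : Measurable u' := by fun_prop (disch := assumption)
  have hu'0 : ∀ y, 0 ≤ u' y := fun y => by
    have hind : t * A.indicator u y ≤ u y :=
      (mul_le_of_le_one_left (indicator_nonneg (fun y _ => hu0 y) y) ht1.le).trans
        (indicator_le_self' (fun y _ => hu0 y) y)
    linarith [indicator_nonneg (fun y (_ : y ∈ B) => hκ.le) y]
  set F := fun y => f (u y) - t * deriv f ((1 - t) * s) * A.indicator u y
    + B.indicator (fun _ => κ * deriv f (s' + κ)) y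
  have hFA := (hui.indicator hA).const_mul (t * deriv f ((1 - t) * s))
  have hFB := (integrable_const (μ := ρ) (κ * deriv f (s' + κ))).indicator hB
  have hfuA : Integrable (fun y => f (u y) - t * deriv f ((1 - t) * s) * A.indicator u y) ρ :=
    hfu.sub hFA
  have hF : Integrable F ρ := hfuA.add hFB
  have hle : ∀ y, f (u' y) ≤ F y := fun y => by
    by_cases hyA : y ∈ A
    · have hyB : y ∉ B := disjoint_left.1 hAB hyA
      simpa [u', F, hyA, hyB, sub_mul, mul_right_comm] using
        hf.apply_one_sub_mul_le hs (hAs y hyA) ht0 ht1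
    · by_cases hyB : y ∈ B
      · simpa [u', F, hyA, hyB] using hf.apply_add_le (hu0 y) (hBs y hyB) hκ
      · simp [u', F, hyA, hyB]
  obtain ⟨l, hl⟩ := hf.exists_forall_nonneg_le
  have hfu' : Integrable (fun y => f (u' y)) ρ :=
    integrable_of_le_of_le (hf.measurable_comp hu' hu'0).aestronglyMeasurable
      (.of_forall fun y => hl _ (hu'0 y)) (.of_forall hle) (integrable_const l) hF
  refine ⟨hfu', (integral_mono hfu' hF hle).trans_eq ?_⟩
  simp only [F]
  rw [integral_add hfuA hFB, integral_sub hfu hFA, integral_const_mul,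
    integral_indicator hA, integral_indicator_const _ hB, smul_eq_mul]

lemma IsCongestionFunction.exists_deriv_add_lt (hf : IsCongestionFunction f) {L : ℝ} (hs : 0 < s)
    (hs' : 0 < s') (h : deriv f s' + L < deriv f s) (b : ℝ) :
    ∃ t, 0 < t ∧ t < 1 ∧ deriv f (s' + t * b) + L < deriv f ((1 - t) * s) := by
  have hcont : ∀ {x}, 0 < x → ContinuousAt (deriv f) x := fun hx =>
    hf.continuousOn_deriv.continuousAt (Ioi_mem_nhds hx)
  have hleft : ContinuousAt (fun t : ℝ => deriv f (s' + t * b) + L) 0 := by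
    refine ContinuousAt.add (ContinuousAt.comp (g := deriv f) ?_ (by fun_prop)) continuousAt_const
    simpa using hcont hs'
  have hright : ContinuousAt (fun t : ℝ => deriv f ((1 - t) * s)) 0 := by
    refine ContinuousAt.comp (g := deriv f) ?_ (by fun_prop)
    simpa using hcont hs
  have hev := hleft.eventually_lt hright (by simpa using h)
  obtain ⟨t, ht, ht0, ht1⟩ :=
    ((hev.filter_mono nhdsWithin_le_nhds).and (Ioo_mem_nhdsGT (zero_lt_one (α := ℝ)))).exists
  exact ⟨t, ht0, ht1, ht⟩

end Variation

section LipschitzExtension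

variable {α : Type*} [PseudoMetricSpace α] {f : ℝ → ℝ} {u : α → ℝ} {G : Set α} {M : ℝ≥0}

lemma IsCongestionFunction.pos_of_deriv_le_deriv_add (hf : IsCongestionFunction f)
    (hu0 : ∀ y, 0 ≤ u y) (hu : ∃ y ∈ G, u y ≠ 0)
    (hG : ∀ y₁ ∈ G, ∀ y₂ ∈ G, ∀ s s', 0 < s → s < u y₁ → u y₂ < s' →
      deriv f s ≤ deriv f s' + M * dist y₁ y₂) {y₂ : α} (hy₂ : y₂ ∈ G) : 0 < u y₂ := by
  refine (hu0 y₂).lt_of_ne' fun hzero => ?_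
  obtain ⟨y₁, hy₁, hne⟩ := hu
  have hpos : 0 < u y₁ := (hu0 y₁).lt_of_ne' hne
  obtain ⟨s', hs', hlt⟩ := hf.exists_deriv_lt (deriv f (u y₁ / 2) - M * dist y₁ y₂)
  linarith [hG y₁ hy₁ y₂ hy₂ (u y₁ / 2) s' (half_pos hpos) (half_lt_self hpos) (hzero ▸ hs')]

lemma IsCongestionFunction.exists_lipschitzWith_eqOn (hf : IsCongestionFunction f)
    (hu0 : ∀ y, 0 ≤ u y) (hu : ∃ y ∈ G, u y ≠ 0)
    (hG : ∀ y₁ ∈ G, ∀ y₂ ∈ G, ∀ s s', 0 < s → s < u y₁ → u y₂ < s' →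
      deriv f s ≤ deriv f s' + M * dist y₁ y₂) :
    ∃ g : α → ℝ, LipschitzWith M g ∧ EqOn u (fun y => derivInv f (g y)) G := by
  have hpos : ∀ y ∈ G, 0 < u y := fun y => hf.pos_of_deriv_le_deriv_add hu0 hu hG
  have hlip : LipschitzOnWith M (fun y => deriv f (u y)) G := by
    refine .of_le_add_mul M fun y₁ hy₁ y₂ hy₂ => le_of_forall_pos_le_add fun ε hε => ?_
    have hs : derivInv f (deriv f (u y₁) - ε / 2) < u y₁ := by
      nth_rw 2 [← hf.derivInv_deriv (hpos y₁ hy₁)]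
      exact hf.strictMono_derivInv (by linarith)
    have hs' : u y₂ < derivInv f (deriv f (u y₂) + ε / 2) := by
      nth_rw 1 [← hf.derivInv_deriv (hpos y₂ hy₂)]
      exact hf.strictMono_derivInv (by linarith)
    have hle := hG y₁ hy₁ y₂ hy₂ _ _ (hf.derivInv_pos _) hs hs'
    rw [hf.deriv_derivInv, hf.deriv_derivInv] at hle
    linarith
  obtain ⟨g, hg, hgu⟩ := hlip.extend_real
  exact ⟨g, hg, fun y hy => by simp only [← hgu hy, hf.derivInv_deriv (hpos y hy)]⟩

end LipschitzExtension

section EssentialPoint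

variable {α β : Type*} [TopologicalSpace α] [MeasurableSpace α] [TopologicalSpace β]

/-- The point `y` is essential for `u` with respect to `μ` if the values of `u` near `u y` are taken
on a set of positive measure in every neighbourhood of `y`. This is a weak form of approximate
continuity that suffices to pass from estimates on sets of positive measure to pointwise ones. -/
def IsEssentialPoint (μ : Measure α) (u : α → β) (y : α) : Prop :=
  ∀ V ∈ 𝓝 y, ∀ U ∈ 𝓝 (u y), μ (V ∩ u ⁻¹' U) ≠ 0

lemma ae_isEssentialPoint [SecondCountableTopology α] [SecondCountableTopology β]
    (μ : Measure α) (u : α → β) : ∀ᵐ y ∂μ, IsEssentialPoint μ u y := by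
  have hbasis : ∀ U ∈ TopologicalSpace.countableBasis β, ∀ᵐ y ∂μ, u y ∈ U →
      ∀ V ∈ 𝓝 y, μ (V ∩ u ⁻¹' U) ≠ 0 := by
    refine fun U _ => measure_null_of_locally_null _ fun y hy => ?_
    simp only [mem_compl_iff, mem_ofPred_eq, not_forall, not_not] at hy
    obtain ⟨-, V, hV, hnull⟩ := hy
    refine ⟨V ∩ u ⁻¹' U, inter_mem (mem_nhdsWithin_of_mem_nhds hV) ?_, hnull⟩
    filter_upwards [self_mem_nhdsWithin] with z hz
    by_contra hzU
    exact hz fun hzU' => absurd hzU' hzU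
  filter_upwards [(ae_ball_iff (TopologicalSpace.countable_countableBasis β)).2 hbasis]
    with y hy V hV U hU
  obtain ⟨U', hU', hyU', hsub⟩ :=
    (TopologicalSpace.isBasis_countableBasis β).mem_nhds_iff.1 hU
  exact fun hnull => hy U' hU' hyU' V hV
    (measure_mono_null (inter_subset_inter_right V (preimage_mono hsub)) hnull)

end EssentialPoint

section Minimizer

variable {m n : ℕ} {Y A B : Set (E n)} {f : ℝ → ℝ} {ν ν' : Measure (E n)} {s s' : ℝ}

lemma congestion_ne_top_iff :
    congestion Y f ν ≠ ⊤ ↔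
      ν ≪ volume.restrict Y ∧ IntegrableOn (fun y => f (density ν y)) Y := by
  unfold congestion
  split_ifs with h <;> simp [h]

lemma congestion_eq_coe (h : congestion Y f ν ≠ ⊤) :
    congestion Y f ν = (∫ y in Y, f (density ν y) : ℝ) :=
  if_pos (congestion_ne_top_iff.1 h)

lemma cond_mem_probOn {T : Set (E n)} (hB : MeasurableSet B) (hB0 : volume B ≠ 0)
    (hB' : volume B ≠ ∞) (hBT : B ⊆ T) : volume[|B] ∈ probOn T :=
  ⟨ProbabilityTheory.cond_isProbabilityMeasure_of_finite hB0 hB',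
    (ProbabilityTheory.ae_cond_mem hB).mono hBT⟩

lemma cond_absolutelyContinuous_restrict (hBY : B ⊆ Y) : volume[|B] ≪ volume.restrict Y :=
  Measure.smul_absolutelyContinuous.trans
    (Measure.restrict_mono_set volume hBY).absolutelyContinuous

lemma congestion_cond_ne_top (hY : MeasurableSet Y) (hY0 : volume Y ≠ 0) (hY' : volume Y ≠ ∞) :
    congestion Y f volume[|Y] ≠ ⊤ := by
  refine congestion_ne_top_iff.2 ⟨cond_absolutelyContinuous_restrict subset_rfl, ?_⟩
  refine (integrableOn_const hY' (C := f (volume.real Y)⁻¹)).congr ?_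
  filter_upwards [ae_restrict_of_ae (density_cond hY hY0), ae_restrict_mem hY] with y hy hyY
  rw [hy, indicator_of_mem hyY]

lemma measureReal_pos_of_density_pos [IsFiniteMeasure ν] (hν : ν ≪ volume)
    (hA0 : volume A ≠ 0) (hpos : ∀ y ∈ A, 0 < density ν y) : 0 < ν.real A := by
  rw [← setIntegral_density hν, setIntegral_pos_iff_support_of_nonneg_ae
    (.of_forall fun y => density_nonneg y) integrable_density.integrableOn,
    inter_eq_right.2 fun y hy => Function.mem_support.2 (hpos y hy).ne']
  exact pos_iff_ne_zero.2 hA0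

lemma integrableOn_and_setIntegral_density_transfer_le [IsFiniteMeasure ν]
    (hf : IsCongestionFunction f) (hY : volume Y ≠ ∞) (hν : congestion Y f ν ≠ ⊤)
    (hA : MeasurableSet A) (hAY : A ⊆ Y) (hA0 : volume A ≠ 0) (hB : MeasurableSet B)
    (hBY : B ⊆ Y) (hB0 : volume B ≠ 0) (hAB : Disjoint A B) (hs : 0 < s)
    (hAs : ∀ y ∈ A, s ≤ density ν y) (hBs : ∀ y ∈ B, density ν y ≤ s') {t : ℝ≥0} (ht0 : 0 < t)
    (ht1 : t < 1) :
    IntegrableOn (fun y => f (density (transfer ν A volume[|B] t) y)) Y ∧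
      ∫ y in Y, f (density (transfer ν A volume[|B] t) y)
        ≤ (∫ y in Y, f (density ν y)) + t * ν.real A *
          (deriv f (s' + t * (ν.real A / volume.real B)) - deriv f ((1 - t) * s)) := by
  obtain ⟨hνY, hfν⟩ := congestion_ne_top_iff.1 hν
  have hνvol : ν ≪ volume := hνY.trans Measure.absolutelyContinuous_restrict
  have hB' : volume B ≠ ∞ := measure_ne_top_of_subset hBY hY
  have := isFiniteMeasure_restrict.2 hY
  have := ProbabilityTheory.cond_isProbabilityMeasure_of_finite hB0 hB'
  have hνA : 0 < ν.real A :=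
    measureReal_pos_of_density_pos hνvol hA0 fun y hy => hs.trans_le (hAs y hy)
  have hvolB : 0 < volume.real B := ENNReal.toReal_pos hB0 hB'
  set κ : ℝ := t * (ν.real A / volume.real B) with hκ
  have hκ0 : 0 < κ := by positivity
  have hdensity : ∀ᵐ y ∂volume.restrict Y, density (transfer ν A volume[|B] t) y
      = density ν y - t * A.indicator (density ν) y + B.indicator (fun _ => κ) y := by
    filter_upwards [ae_restrict_of_ae (density_transfer (ν := ν) (τ := volume[|B]) hA ht1.le),
      ae_restrict_of_ae (density_cond hB hB0)] with y hy hyB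
    rw [hy, hyB]
    by_cases hyB' : y ∈ B
    · simp [hyB', hκ, div_eq_mul_inv, mul_assoc]
    · simp [hyB']
  obtain ⟨hint, hle⟩ := integrable_and_integral_comp_sub_add_le hf measurable_density
    density_nonneg integrable_density.restrict hfν hA hB hAB hs hAs hBs t.coe_nonneg ht1 hκ0
  refine ⟨hint.congr (hdensity.mono fun y hy => congrArg f hy.symm), ?_⟩
  rw [integral_congr_ae (hdensity.mono fun y hy => congrArg f hy)]
  rw [Measure.restrict_restrict_of_subset hAY, setIntegral_density hνvol,
    measureReal_restrict_apply hB, inter_eq_left.2 hBY] at hle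
  refine hle.trans_eq ?_
  have hmass : volume.real B * κ = t * ν.real A := by rw [hκ]; field_simp
  rw [← mul_assoc, hmass]
  ring

namespace IsMinimizer

variable {c : E m → E n → ℝ} {μ : Measure (E m)}

lemma congestion_ne_top (hν : IsMinimizer Y c f μ ν) (hY : MeasurableSet Y) (hY0 : volume Y ≠ 0)
    (hY' : volume Y ≠ ∞) : congestion Y f ν ≠ ⊤ := by
  intro htop
  have hle := isMinOn_iff.1 hν.2 _ (cond_mem_probOn hY hY0 hY' subset_closure)
  have huniform := congestion_cond_ne_top (f := f) hY hY0 hY'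
  rw [energy, energy, htop, EReal.coe_add_top, congestion_eq_coe huniform,
    ← EReal.coe_add, top_le_iff] at hle
  exact EReal.coe_ne_top _ hle

lemma transportCost_add_setIntegral_le (hν : IsMinimizer Y c f μ ν)
    (hν' : ν' ∈ probOn (closure Y)) (hfν : congestion Y f ν ≠ ⊤) (hfν' : congestion Y f ν' ≠ ⊤) :
    transportCost c μ ν + ∫ y in Y, f (density ν y)
      ≤ transportCost c μ ν' + ∫ y in Y, f (density ν' y) := by
  have hle := isMinOn_iff.1 hν.2 _ hν'
  rw [energy, energy, congestion_eq_coe hfν, congestion_eq_coe hfν'] at hle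
  exact_mod_cast hle

lemma deriv_le_deriv_add {S : Set (E m)} {L : ℝ} (hν : IsMinimizer Y c f μ ν)
    (hf : IsCongestionFunction f) (hS : IsCompact S) (hYb : Bornology.IsBounded Y)
    (hc : ContinuousOn (fun p : E m × E n => c p.1 p.2) (S ×ˢ closure Y)) (hμ : μ ∈ probOn S)
    (hfν : congestion Y f ν ≠ ⊤) (hA : MeasurableSet A) (hAY : A ⊆ Y) (hA0 : volume A ≠ 0)
    (hB : MeasurableSet B) (hBY : B ⊆ Y) (hB0 : volume B ≠ 0) (hs : 0 < s)
    (hAs : ∀ y ∈ A, s < density ν y) (hBs : ∀ y ∈ B, density ν y < s') (hL0 : 0 ≤ L)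
    (hL : ∀ x ∈ S, ∀ y ∈ A, ∀ y' ∈ B, c x y' ≤ c x y + L) :
    deriv f s ≤ deriv f s' + L := by
  by_contra! hlt
  have := hν.1.1
  obtain ⟨y', hy'⟩ := nonempty_of_measure_ne_zero hB0
  have hs' : 0 < s' := (density_nonneg y').trans_lt (hBs y' hy')
  have hs's : s' < s := (hf.strictMonoOn_deriv.lt_iff_lt hs' hs).1 (by linarith)
  have hAB : Disjoint A B :=
    disjoint_left.2 fun y hyA hyB => (hs's.trans (hAs y hyA)).not_gt (hBs y hyB)
  have hY : volume Y ≠ ∞ := hYb.measure_lt_top.ne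
  have hB' : volume B ≠ ∞ := measure_ne_top_of_subset hBY hY
  obtain ⟨hνY, -⟩ := congestion_ne_top_iff.1 hfν
  have hνA : 0 < ν.real A := measureReal_pos_of_density_pos
    (hνY.trans Measure.absolutelyContinuous_restrict) hA0 fun y hy => hs.trans (hAs y hy)
  obtain ⟨t, ht0, ht1, ht⟩ :=
    hf.exists_deriv_add_lt hs hs' hlt (ν.real A / volume.real B)
  lift t to ℝ≥0 using ht0.le
  have hBclosure : B ⊆ closure Y := hBY.trans subset_closure
  have hν'mem : transfer ν A volume[|B] t ∈ probOn (closure Y) :=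
    transfer_mem_probOn hν.1 (cond_mem_probOn hB hB0 hB' hBclosure) hA ht1.le
  obtain ⟨hint, hcongestion⟩ := integrableOn_and_setIntegral_density_transfer_le hf hY hfν hA hAY
    hA0 hB hBY hB0 hAB hs (fun y hy => (hAs y hy).le) (fun y hy => (hBs y hy).le) ht0 ht1
  have htransport := transportCost_transfer_le hS hYb.isCompact_closure hc hμ hν.1
    (cond_mem_probOn hB hB0 hB' subset_rfl) hBclosure hA ht1.le hL
  have hmin := hν.transportCost_add_setIntegral_le hν'mem hfν <| congestion_ne_top_iff.2
    ⟨transfer_absolutelyContinuous hνY (cond_absolutelyContinuous_restrict hBY), hint⟩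
  have hgain : 0 < t * ν.real A * (deriv f ((1 - t) * s)
      - (deriv f (s' + t * (ν.real A / volume.real B)) + L)) :=
    mul_pos (mul_pos ht0 hνA) (sub_pos.2 ht)
  linarith

lemma deriv_le_deriv_add_mul_dist {S : Set (E m)} {M : ℝ≥0} (hν : IsMinimizer Y c f μ ν)
    (hf : IsCongestionFunction f) (hS : IsCompact S) (hYb : Bornology.IsBounded Y)
    (hYm : MeasurableSet Y)
    (hc : ContinuousOn (fun p : E m × E n => c p.1 p.2) (S ×ˢ closure Y))
    (hcM : ∀ x ∈ S, LipschitzOnWith M (c x) (closure Y)) (hμ : μ ∈ probOn S)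
    (hfν : congestion Y f ν ≠ ⊤) {y₁ y₂ : E n}
    (hy₁ : IsEssentialPoint (volume.restrict Y) (density ν) y₁)
    (hy₂ : IsEssentialPoint (volume.restrict Y) (density ν) y₂)
    (hs : 0 < s) (hs₁ : s < density ν y₁) (hs₂ : density ν y₂ < s') :
    deriv f s ≤ deriv f s' + M * dist y₁ y₂ := by
  suffices hr : ∀ r > 0, deriv f s ≤ deriv f s' + M * (dist y₁ y₂ + 2 * r) by
    have hlim : Tendsto (fun r : ℝ => deriv f s' + M * (dist y₁ y₂ + 2 * r)) (𝓝[>] 0)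
        (𝓝 (deriv f s' + M * (dist y₁ y₂ + 2 * 0))) :=
      (Continuous.tendsto (by fun_prop) 0).mono_left nhdsWithin_le_nhds
    simpa using ge_of_tendsto hlim (eventually_mem_nhdsWithin.mono hr)
  intro r hr
  set A := Metric.ball y₁ r ∩ density ν ⁻¹' Ioi s
  set B := Metric.ball y₂ r ∩ density ν ⁻¹' Iio s'
  have hA : MeasurableSet A := measurableSet_ball.inter (measurable_density measurableSet_Ioi)
  have hB : MeasurableSet B := measurableSet_ball.inter (measurable_density measurableSet_Iio)
  refine hν.deriv_le_deriv_add (A := A ∩ Y) (B := B ∩ Y) hf hS hYb hc hμ hfν (hA.inter hYm)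
    inter_subset_right ?_ (hB.inter hYm) inter_subset_right ?_ hs (fun y hy => hy.1.2)
    (fun y hy => hy.1.2) (by positivity) fun x hx y hy y' hy' => ?_
  · rw [← Measure.restrict_apply hA]
    exact hy₁ _ (Metric.ball_mem_nhds _ hr) _ (Ioi_mem_nhds hs₁)
  · rw [← Measure.restrict_apply hB]
    exact hy₂ _ (Metric.ball_mem_nhds _ hr) _ (Iio_mem_nhds hs₂)
  · have hdist : dist y' y ≤ dist y₁ y₂ + 2 * r := by
      linarith [dist_triangle4 y' y₂ y₁ y, dist_comm y₁ y₂, Metric.mem_ball.1 hy'.1.1,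
        Metric.mem_ball'.1 hy.1.1]
    calc c x y' ≤ c x y + M * dist y' y :=
          (hcM x hx).le_add_mul (subset_closure hy'.2) (subset_closure hy.2)
      _ ≤ c x y + M * (dist y₁ y₂ + 2 * r) := by gcongr

lemma setIntegral_density_eq_one (hν : IsMinimizer Y c f μ ν) (hYm : MeasurableSet Y)
    (hfν : congestion Y f ν ≠ ⊤) : ∫ y in Y, density ν y = 1 := by
  have := hν.1.1
  obtain ⟨hνY, -⟩ := congestion_ne_top_iff.1 hfν
  rw [setIntegral_density (hνY.trans Measure.absolutelyContinuous_restrict),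
    ← probReal_univ (μ := ν)]
  exact measureReal_congr (eventuallyEq_univ.2 (hνY.ae_le (ae_restrict_mem hYm)))

lemma exists_lipschitzWith_density_ae_eq {S : Set (E m)} {M : ℝ≥0} (hν : IsMinimizer Y c f μ ν)
    (hf : IsCongestionFunction f) (hS : IsCompact S) (hYb : Bornology.IsBounded Y)
    (hYm : MeasurableSet Y)
    (hc : ContinuousOn (fun p : E m × E n => c p.1 p.2) (S ×ˢ closure Y))
    (hcM : ∀ x ∈ S, LipschitzOnWith M (c x) (closure Y)) (hμ : μ ∈ probOn S)
    (hfν : congestion Y f ν ≠ ⊤) :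
    ∃ g : E n → ℝ, LipschitzWith M g ∧
      ∀ᵐ y ∂volume.restrict Y, density ν y = derivInv f (g y) := by
  have hG := ae_isEssentialPoint (volume.restrict Y) (density ν)
  have hne : ∃ y ∈ {y | IsEssentialPoint (volume.restrict Y) (density ν) y}, density ν y ≠ 0 := by
    by_contra! hzero
    have hint := hν.setIntegral_density_eq_one hYm hfν
    rw [integral_eq_zero_of_ae (hG.mono hzero)] at hint
    exact zero_ne_one hint
  obtain ⟨g, hg, hgν⟩ := hf.exists_lipschitzWith_eqOn density_nonneg hne
    fun y₁ hy₁ y₂ hy₂ s s' => hν.deriv_le_deriv_add_mul_dist hf hS hYb hYm hc hcM hμ hfν hy₁ hy₂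
  exact ⟨g, hg, hG.mono hgν⟩

end IsMinimizer

end Minimizer

lemma lipschitzOnWith_lipConst {m n : ℕ} {X : Set (E m)} {Y : Set (E n)} {c : E m → E n → ℝ}
    (hcLip : BddAbove (lipQuotients X Y c)) {x : E m} (hx : x ∈ closure X) :
    LipschitzOnWith (lipConst X Y c).toNNReal (c x) (closure Y) := by
  refine .of_le_add_mul' _ fun y₀ hy₀ y₁ hy₁ => ?_
  rcases eq_or_ne y₀ y₁ with rfl | hne
  · simp
  · have hquot : |c x y₀ - c x y₁| / ‖y₀ - y₁‖ ≤ lipConst X Y c :=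
      le_csSup hcLip ⟨x, hx, y₀, hy₀, y₁, hy₁, hne, rfl⟩
    rw [div_le_iff₀ (norm_sub_pos_iff.2 hne), ← dist_eq_norm] at hquot
    linarith [le_abs_self (c x y₀ - c x y₁)]

lemma lipConst_nonneg {m n : ℕ} {X : Set (E m)} {Y : Set (E n)} {c : E m → E n → ℝ} :
    0 ≤ lipConst X Y c := by
  refine Real.sSup_nonneg ?_
  rintro _ ⟨x, -, y₀, -, y₁, -, -, rfl⟩
  positivity

end CongestionOT

open CongestionOT in
theorem mainTheorem4_general {m n : ℕ} (X : Set (E m)) (Y : Set (E n))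
    (hXb : Bornology.IsBounded X) (hYb : Bornology.IsBounded Y) (hYm : MeasurableSet Y)
    (hY0 : volume Y ≠ 0) (y₀ : E n) (c : E m → E n → ℝ)
    (hc : ContinuousOn (fun p : E m × E n => c p.1 p.2) (closure X ×ˢ closure Y))
    (hcLip : BddAbove (lipQuotients X Y c)) (f : ℝ → ℝ) (hf : IsCongestionFunction f)
    (μ : Measure (E m)) (hμ : μ ∈ probOn (closure X)) (ν : Measure (E n))
    (hν : IsMinimizer Y c f μ ν) :
    ν ≪ volume.restrict Y ∧
    ∀ᵐ y ∂(volume.restrict Y),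
      derivInv f (K Y f (fun z => -(lipConst X Y c * ‖z - y₀‖)) 1 - lipConst X Y c * ‖y - y₀‖)
        ≤ density ν y ∧
      density ν y
        ≤ derivInv f (K Y f (fun z => lipConst X Y c * ‖z - y₀‖) 1
          + lipConst X Y c * ‖y - y₀‖) := by
  have hfν := hν.congestion_ne_top hYm hY0 hYb.measure_lt_top.ne
  refine ⟨(congestion_ne_top_iff.1 hfν).1, ?_⟩
  obtain ⟨g, hg, hgν⟩ := hν.exists_lipschitzWith_density_ae_eq hf hXb.isCompact_closure hYb hYm hc
    (fun x => lipschitzOnWith_lipConst hcLip) hμ hfν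
  have hmass : ∫ y in Y, derivInv f (g y) = 1 :=
    (integral_congr_ae hgν).symm.trans (hν.setIntegral_density_eq_one hYm hfν)
  obtain ⟨hlow, hhigh⟩ := mem_Icc_K_of_lipschitzWith hf hYb hYm hY0 hg one_pos hmass y₀
  rw [Real.coe_toNNReal _ lipConst_nonneg] at hlow hhigh
  filter_upwards [hgν] with y hy
  have hgy : |g y - g y₀| ≤ lipConst X Y c * ‖y - y₀‖ := by
    simpa [Real.coe_toNNReal _ lipConst_nonneg, dist_eq_norm] using hg.dist_le_mul y y₀
  have hmono := hf.strictMono_derivInv.monotone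
  rw [hy]
  exact ⟨hmono (by linarith [neg_le_of_abs_le hgy]), hmono (by linarith [le_of_abs_le hgy])⟩

theorem mainTheorem4 {m n : ℕ}
    (X : Set (CongestionOT.E m)) (Y : Set (CongestionOT.E n))
    (hXo : IsOpen X) (hXb : Bornology.IsBounded X)
    (hYo : IsOpen Y) (hYb : Bornology.IsBounded Y)
    (h0 : (0 : CongestionOT.E n) ∈ closure Y)
    (c : CongestionOT.E m → CongestionOT.E n → ℝ)
    (hc : ContinuousOn (fun p : CongestionOT.E m × CongestionOT.E n => c p.1 p.2)
      (closure X ×ˢ closure Y))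
    (hcLip : BddAbove (CongestionOT.lipQuotients X Y c))
    (f : ℝ → ℝ) (hf : CongestionOT.IsCongestionFunction f)
    (μ : Measure (CongestionOT.E m)) (hμ : μ ∈ CongestionOT.probOn (closure X))
    (ν : Measure (CongestionOT.E n)) (hν : CongestionOT.IsMinimizer Y c f μ ν) :
    ν ≪ volume.restrict Y ∧
    ∀ᵐ y ∂(volume.restrict Y),
      CongestionOT.derivInv f
          (CongestionOT.K Y f (fun z => -(CongestionOT.lipConst X Y c * ‖z‖)) 1
            - CongestionOT.lipConst X Y c * ‖y‖)
        ≤ CongestionOT.density ν y ∧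
      CongestionOT.density ν y
        ≤ CongestionOT.derivInv f
          (CongestionOT.K Y f (fun z => CongestionOT.lipConst X Y c * ‖z‖) 1
            + CongestionOT.lipConst X Y c * ‖y‖) := by
  have hY0 := (hYo.measure_pos volume (closure_nonempty_iff.1 ⟨0, h0⟩)).ne'
  simpa only [sub_zero] using
    mainTheorem4_general X Y hXb hYb hYo.measurableSet hY0 0 c hc hcLip f hf μ hμ ν hν
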